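/- Matrices are complex. For integers $p,n\ge 1$, a linear map $\Phi:\mathrm{Mat}(p)\to\mathrm{Mat}(n)$ is completely positive if $\Phi(X)=\sum_{i=1}^r A_iXA_i^\dagger$ for some $A_1,\dots,A_r\in\mathrm{Mat}(n\times p)$. Let $\Phi^*$ be its adjoint for the inner products $\langle X,Y\rangle=\operatorname{tr}(X^\dagger Y)$, so $\Phi^*(Y)=\sum_i A_i^\dagger YA_i$, and let $s(\Phi)=\operatorname{tr}\Phi(I_p)$. The map $\Phi$ is $\varepsilon$-doubly balanced if $$\Big\|\Phi(I_p)-\tfrac{s(\Phi)}{n}I_n\Big\|_{op}\le\frac{s(\Phi)\,\varepsilon}{n}\quad\text{and}\quad\Big\|\Phi^*(I_n)-\tfrac{s(\Phi)}{p}I_p\Big\|_{op}\le\frac{s(\Phi)\,\varepsilon}{p},$$ and doubly balanced if it is $0$-doubly balanced. It is an $(\varepsilon,1-\lambda)$-quantum expander if it is completely positive, $\varepsilon$-doubly balanced, and $$\|\Phi(X)\|_F\le(1-\lambda)\frac{s(\Phi)}{\sqrt{np}}\,\|X\|_F\quad\text{for all Hermitian } X\in\mathrm{Mat}(p)\text{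 with }\operatorname{tr}X=0.$$ For $L\in\mathrm{Mat}(p)$ and $R\in\mathrm{Mat}(n)$ put $\Phi_{L,R}(X)=R\,\Phi(L^\dagger XL)\,R^\dagger$. **Theorem.** There are absolute constants $c,C>0$ such that the following holds for all $p,n\ge1$, all $\varepsilon\ge0$ and all $\lambda\in(0,1]$. If $\Phi:\mathrm{Mat}(p)\to\mathrm{Mat}(n)$ is an $(\varepsilon,1-\lambda)$-quantum expander and $\varepsilon\sqrt p/\lambda\le c$, then there are matrices $L\in\mathrm{Mat}(p)$ and $R\in\mathrm{Mat}(n)$ with $\det L=\det R=1$ such that $\Phi_{L,R}$ is doubly balanced and $$\|I_p-L^\dagger L\|_F\le C\,\frac{\varepsilon\sqrt p}{\lambda},\qquad \|I_n-R^\dagger R\|_{op}\le C\,\frac{\varepsilon\sqrt p}{\lambda}.$$ -/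

import Mathlib

open scoped Matrix

noncomputable section

namespace QuantumExpander

/-- The Frobenius norm of a complex square matrix. -/
def frobNorm {m : ℕ} (M : Matrix (Fin m) (Fin m) ℂ) : ℝ :=
  (Matrix.frobeniusNormedAddCommGroup : NormedAddCommGroup (Matrix (Fin m) (Fin m) ℂ)).norm M

/-- The operator norm of a complex square matrix acting on Euclidean space, i.e. its largest
singular value. -/
def opNorm {m : ℕ} (M : Matrix (Fin m) (Fin m) ℂ) : ℝ :=
  ‖Matrix.toEuclideanCLM (n := Fin m) (𝕜 := ℂ) M‖

/-- The linear map `X ↦ ∑ i, A i * X * (A i)ᴴ` from `p × p` matrices to `n × n` matrices. -/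
def krausMap {p n r : ℕ} (A : Fin r → Matrix (Fin n) (Fin p) ℂ) :
    Matrix (Fin p) (Fin p) ℂ →ₗ[ℂ] Matrix (Fin n) (Fin n) ℂ where
  toFun X := ∑ i, A i * X * (A i)ᴴ
  map_add' X Y := by simp [Matrix.mul_add, Matrix.add_mul, Finset.sum_add_distrib]
  map_smul' a X := by simp [Finset.smul_sum]

/-- A map between matrix spaces is completely positive if it has a Kraus representation. -/
def IsCompletelyPositive {p n : ℕ}
    (Φ : Matrix (Fin p) (Fin p) ℂ →ₗ[ℂ] Matrix (Fin n) (Fin n) ℂ) : Prop :=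
  ∃ (r : ℕ) (A : Fin r → Matrix (Fin n) (Fin p) ℂ), Φ = krausMap A

/-- The size `s(Φ) = tr Φ(I)`; this trace is a nonnegative real number when `Φ` is completely
positive. -/
def size {p n : ℕ} (Φ : Matrix (Fin p) (Fin p) ℂ →ₗ[ℂ] Matrix (Fin n) (Fin n) ℂ) : ℝ :=
  (Φ 1).trace.re

/-- The dual of `Φ`: the Hermitian adjoint for the inner products `⟨X, Y⟩ = tr (Xᴴ Y)`. It is
given through its entries `⟨E_ij, Φ* Y⟩ = ⟨Φ E_ij, Y⟩`. -/
def dual {p n : ℕ} (Φ : Matrix (Fin p) (Fin p) ℂ →ₗ[ℂ] Matrix (Fin n) (Fin n) ℂ) :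
    Matrix (Fin n) (Fin n) ℂ →ₗ[ℂ] Matrix (Fin p) (Fin p) ℂ where
  toFun Y := Matrix.of fun i j => ((Φ (Matrix.single i j 1))ᴴ * Y).trace
  map_add' X Y := by ext i j; simp [Matrix.mul_add]
  map_smul' a X := by ext i j; simp

/-- `dual` is the adjoint for the Frobenius inner products. -/
theorem trace_conjTranspose_mul_dual {p n : ℕ}
    (Φ : Matrix (Fin p) (Fin p) ℂ →ₗ[ℂ] Matrix (Fin n) (Fin n) ℂ)
    (X : Matrix (Fin p) (Fin p) ℂ) (Y : Matrix (Fin n) (Fin n) ℂ) :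
    (Xᴴ * dual Φ Y).trace = ((Φ X)ᴴ * Y).trace := by
  have hX : X = ∑ i, ∑ j, X i j • Matrix.single i j (1 : ℂ) := by
    conv_lhs => rw [Matrix.matrix_eq_sum_single X]
    simp
  have h2 : Φ X = ∑ i, ∑ j, X i j • Φ (Matrix.single i j (1 : ℂ)) := by
    conv_lhs => rw [hX]
    simp only [map_sum, map_smul]
  rw [h2]
  simp only [Matrix.conjTranspose_sum, Matrix.conjTranspose_smul, Matrix.sum_mul,
    Matrix.trace_sum, Matrix.smul_mul, Matrix.trace_smul]
  rw [Finset.sum_comm]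
  simp [Matrix.trace, Matrix.mul_apply, dual]

/-- The dual of a completely positive map in terms of Kraus operators. -/
theorem dual_krausMap {p n r : ℕ} (A : Fin r → Matrix (Fin n) (Fin p) ℂ)
    (Y : Matrix (Fin n) (Fin n) ℂ) :
    dual (krausMap A) Y = ∑ i, (A i)ᴴ * Y * A i := by
  have key : ∀ X : Matrix (Fin p) (Fin p) ℂ,
      (X * dual (krausMap A) Y).trace = (X * ∑ i, (A i)ᴴ * Y * A i).trace := by
    intro X
    have h := trace_conjTranspose_mul_dual (krausMap A) Xᴴ Y
    rw [Matrix.conjTranspose_conjTranspose] at h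
    rw [h]
    simp only [krausMap, LinearMap.coe_mk, AddHom.coe_mk, Matrix.conjTranspose_sum,
      Matrix.conjTranspose_mul, Matrix.conjTranspose_conjTranspose, Matrix.sum_mul,
      Matrix.mul_sum, Matrix.trace_sum]
    refine Finset.sum_congr rfl fun i _ => ?_
    rw [Matrix.mul_assoc, Matrix.trace_mul_comm]
    simp only [Matrix.mul_assoc]
  exact Matrix.ext_iff_trace_mul_left.mpr key

/-- `Φ` is `ε`-doubly balanced. -/
def IsEpsDoublyBalanced {p n : ℕ} (ε : ℝ)
    (Φ : Matrix (Fin p) (Fin p) ℂ →ₗ[ℂ] Matrix (Fin n) (Fin n) ℂ) : Prop :=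
  opNorm (Φ 1 - ((size Φ / n : ℝ) : ℂ) • 1) ≤ size Φ * ε / n ∧
  opNorm (dual Φ 1 - ((size Φ / p : ℝ) : ℂ) • 1) ≤ size Φ * ε / p

/-- `Φ` is doubly balanced: it is `0`-doubly balanced. -/
def IsDoublyBalanced {p n : ℕ}
    (Φ : Matrix (Fin p) (Fin p) ℂ →ₗ[ℂ] Matrix (Fin n) (Fin n) ℂ) : Prop :=
  IsEpsDoublyBalanced 0 Φ

/-- The scaling `Φ_{L,R} : X ↦ R Φ(Lᴴ X L) Rᴴ`. -/
def scaling {p n : ℕ} (Φ : Matrix (Fin p) (Fin p) ℂ →ₗ[ℂ] Matrix (Fin n) (Fin n) ℂ)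
    (L : Matrix (Fin p) (Fin p) ℂ) (R : Matrix (Fin n) (Fin n) ℂ) :
    Matrix (Fin p) (Fin p) ℂ →ₗ[ℂ] Matrix (Fin n) (Fin n) ℂ where
  toFun X := R * Φ (Lᴴ * X * L) * Rᴴ
  map_add' X Y := by simp [Matrix.mul_add, Matrix.add_mul]
  map_smul' a X := by simp

/-- `Φ` is an `(ε, η)`-quantum expander: a completely positive map that is `ε`-doubly balanced
and satisfies `‖Φ(X)‖_F / ‖X‖_F ≤ η s(Φ) / √(n p)` for all nonzero traceless Hermitian `X`. -/
def IsQuantumExpander {p n : ℕ} (ε η : ℝ)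
    (Φ : Matrix (Fin p) (Fin p) ℂ →ₗ[ℂ] Matrix (Fin n) (Fin n) ℂ) : Prop :=
  IsCompletelyPositive Φ ∧ IsEpsDoublyBalanced ε Φ ∧
  ∀ X : Matrix (Fin p) (Fin p) ℂ, X.IsHermitian → X.trace = 0 →
    frobNorm (Φ X) ≤ η * (size Φ / Real.sqrt ((n : ℝ) * p)) * frobNorm X

end QuantumExpander

end

noncomputable section

namespace QuantumExpander

/-! The scaling comes from minimising `det Φ(P)` over positive `P` with `det P = 1` in the Frobenius
ball of radius `δ = 32 ε √p / λ` about the identity. The ball is compact, so a minimiser exists; the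
work is to show that it lies in the interior, after which first-order optimality gives double
balance.

Interior (`sum_sub_one_sq_lt`): in eigenbases of `P` and `Φ(P)` the map becomes a nonnegative matrix
`c` with nearly constant row and column sums. Let `d`, `μ` be the eigenvalues and `g` the geometric
mean of `μ`. With `x = log d` and `z = log (g / μ)`, both of sum zero, `n g = ∑ c i j * exp (x i + z
j)`. A quadratic minorant of `exp`, with the spectral gap controlling the cross term, bounds this
below by `s (1 - ε (a + b) + (λ - ε)(a² + b²) / 4)`, where `a`, `b` are the root mean squares of
`x`, `z` (`le_sum_mul_exp_add`). On the boundary sphere `a ≥ 16 ε / λ`, so `n g > s`. But minimality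
and AM-GM give `n g ≤ tr Φ(1) = s`.

Optimality: let `Y = g Φ(P)⁻¹`, which has determinant one. By AM-GM (`mul_le_re_trace_mul`), `tr (Y
Φ(Q)) ≥ n (det Φ(Q))^(1/n)`, with equality at `Q = P`. Hence `Q ↦ tr (Y Φ(Q))` has a constrained
local minimum at `P`, which forces `√P Φ*(Y) √P` to be scalar (`exists_eq_smul_one_of_isLocalMin`).
The scaling matrices are `L = √P` and `R = √Y`. -/

/-! ### Convexity estimate for nearly balanced nonnegative matrices -/

/-- Since `x` has sum zero, `r` may be replaced by `r - q`; Cauchy-Schwarz then bounds the `ℓ¹` norm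
of `x` by `m a`. This controls the first-order terms of the exponential sum. -/
theorem neg_le_sum_mul_of_sum_eq_zero {m : ℕ} (hm : 0 < m) {r x : Fin m → ℝ} {q t a : ℝ}
    (hr : ∀ i, |r i - q| ≤ t) (hx : ∑ i, x i = 0) (ha : 0 ≤ a)
    (hxa : ∑ i, x i ^ 2 = m * a ^ 2) : -(m * (t * a)) ≤ ∑ i, x i * r i := by
  have ht : 0 ≤ t := (abs_nonneg _).trans (hr ⟨0, hm⟩)
  have h1 : ∑ i, x i * r i = ∑ i, x i * (r i - q) := by
    simp only [mul_sub, Finset.sum_sub_distrib, ← Finset.sum_mul, hx, zero_mul, sub_zero]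
  have h2 : ∀ i, -(|x i| * t) ≤ x i * (r i - q) := fun i => by
    have := neg_abs_le (x i * (r i - q))
    rw [abs_mul] at this
    have := mul_le_mul_of_nonneg_left (hr i) (abs_nonneg (x i))
    linarith
  have h3 : ∑ i, |x i| ≤ m * a := by
    have h := sq_sum_le_card_mul_sum_sq (s := Finset.univ) (f := fun i => |x i|)
    simp only [sq_abs, hxa, Finset.card_univ, Fintype.card_fin] at h
    exact abs_le_of_sq_le_sq' (h.trans_eq (by ring)) (by positivity) |>.2
  rw [h1]
  refine le_trans ?_ (Finset.sum_le_sum fun i _ => h2 i)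
  rw [Finset.sum_neg_distrib, ← Finset.sum_mul]
  nlinarith

theorem mul_sum_sq_le_sum_sq_mul {m : ℕ} {r x : Fin m → ℝ} {q t : ℝ}
    (hr : ∀ i, |r i - q| ≤ t) : (q - t) * ∑ i, x i ^ 2 ≤ ∑ i, x i ^ 2 * r i := by
  rw [Finset.mul_sum]
  refine Finset.sum_le_sum fun i _ => ?_
  have := (abs_le.1 (hr i)).1
  nlinarith [sq_nonneg (x i)]

/-- Squaring `1 + u/2 ≤ exp (u/2)` gives a minorant with the correct linear term. Its quadratic
coefficient 1/4, instead of 1/2, only affects absolute constants. -/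
theorem sq_one_add_half_le_exp {u : ℝ} (hu : -2 ≤ u) : (1 + u / 2) ^ 2 ≤ Real.exp u := by
  have h : Real.exp u = Real.exp (u / 2) ^ 2 := by rw [← Real.exp_nat_mul]; congr 1; push_cast; ring
  rw [h]
  have := Real.add_one_le_exp (u / 2)
  exact pow_le_pow_left₀ (by linarith) (by linarith) 2

/-- A quantitative convexity estimate for the potential of the matrix scaling problem. -/
theorem le_sum_mul_exp_add {p n : ℕ} (hp : 0 < p) (hn : 0 < n) {c : Fin p → Fin n → ℝ}
    (hc : ∀ i j, 0 ≤ c i j) {s ε lam a b : ℝ} (hs : 0 < s) (hlam : lam ≤ 1)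
    (hsum : ∑ i, ∑ j, c i j = s)
    (hcol : ∀ i, |∑ j, c i j - s / p| ≤ s * ε / p) (hrow : ∀ j, |∑ i, c i j - s / n| ≤ s * ε / n)
    {x : Fin p → ℝ} {z : Fin n → ℝ} (hx : ∑ i, x i = 0) (hz : ∑ j, z j = 0)
    (ha : 0 ≤ a) (hb : 0 ≤ b) (hxa : ∑ i, x i ^ 2 = p * a ^ 2) (hzb : ∑ j, z j ^ 2 = n * b ^ 2)
    (hlow : ∀ i j, -2 ≤ x i + z j)
    (hcross : -((1 - lam) * s * (a * b)) ≤ ∑ i, ∑ j, c i j * (x i * z j)) :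
    s * (1 - ε * (a + b) + (lam - ε) / 4 * (a ^ 2 + b ^ 2)) ≤
      ∑ i, ∑ j, c i j * Real.exp (x i + z j) := by
  have hp' : (p : ℝ) ≠ 0 := by positivity
  have hn' : (n : ℝ) ≠ 0 := by positivity
  have h1 : ∑ i, ∑ j, c i j * (1 + (x i + z j) / 2) ^ 2 ≤
      ∑ i, ∑ j, c i j * Real.exp (x i + z j) :=
    Finset.sum_le_sum fun i _ => Finset.sum_le_sum fun j _ =>
      mul_le_mul_of_nonneg_left (sq_one_add_half_le_exp (hlow i j)) (hc i j)
  have h2 : ∑ i, ∑ j, c i j * (1 + (x i + z j) / 2) ^ 2 =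
      ∑ i, ∑ j, c i j + ∑ i, x i * ∑ j, c i j + ∑ j, z j * ∑ i, c i j +
      (1 / 4) * ∑ i, x i ^ 2 * ∑ j, c i j + (1 / 4) * ∑ j, z j ^ 2 * ∑ i, c i j +
      (1 / 2) * ∑ i, ∑ j, c i j * (x i * z j) := by
    have e1 : ∑ j, z j * ∑ i, c i j = ∑ i, ∑ j, z j * c i j := by
      rw [Finset.sum_comm]; simp only [Finset.mul_sum]
    have e2 : ∑ j, z j ^ 2 * ∑ i, c i j = ∑ i, ∑ j, z j ^ 2 * c i j := by
      rw [Finset.sum_comm]; simp only [Finset.mul_sum]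
    rw [e1, e2]
    simp only [Finset.mul_sum, ← Finset.sum_add_distrib]
    refine Finset.sum_congr rfl fun i _ => Finset.sum_congr rfl fun j _ => ?_
    ring
  have h3 := neg_le_sum_mul_of_sum_eq_zero hp hcol hx ha hxa
  have h4 := neg_le_sum_mul_of_sum_eq_zero hn hrow hz hb hzb
  have h5 := mul_sum_sq_le_sum_sq_mul (x := x) hcol
  have h6 := mul_sum_sq_le_sum_sq_mul (x := z) hrow
  rw [hxa] at h5
  rw [hzb] at h6
  have e3 : (p : ℝ) * (s * ε / p * a) = s * ε * a := by field_simp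
  have e4 : (n : ℝ) * (s * ε / n * b) = s * ε * b := by field_simp
  have e5 : (s / p - s * ε / p) * (p * a ^ 2) = s * (1 - ε) * a ^ 2 := by field_simp
  have e6 : (s / n - s * ε / n) * (n * b ^ 2) = s * (1 - ε) * b ^ 2 := by field_simp
  rw [e3] at h3
  rw [e4] at h4
  rw [e5] at h5
  rw [e6] at h6
  rw [h2, hsum] at h1
  -- By `2ab ≤ a² + b²` the cross term costs at most `s (1 - lam)(a² + b²) / 4`; subtracted from the
  -- diagonal gain `s (1 - ε)(a² + b²) / 4`, it leaves the factor `lam - ε`.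
  have h7 : 0 ≤ s * (1 - lam) * (a - b) ^ 2 :=
    mul_nonneg (mul_nonneg hs.le (by linarith)) (sq_nonneg _)
  nlinarith

/-! ### Logarithms and geometric means near one -/

/-- Converts a Frobenius distance of `P` from the identity into a lower bound on the size of its
log-eigenvalues. -/
theorem abs_sub_one_le_two_mul_abs_log {d : ℝ} (hd : |d - 1| ≤ 1 / 2) :
    |d - 1| ≤ 2 * |Real.log d| := by
  obtain ⟨h1, h2⟩ := abs_le.1 hd
  have hd0 : 0 < d := by linarith
  rcases le_total 1 d with h | h
  · rw [abs_of_nonneg (by linarith), abs_of_nonneg (Real.log_nonneg h)]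
    have h3 := Real.one_sub_inv_le_log_of_pos hd0
    have h4 : (d - 1) / 2 ≤ 1 - d⁻¹ := by
      rw [← sub_nonneg]
      have : 1 - d⁻¹ - (d - 1) / 2 = (d - 1) * (2 - d) / (2 * d) := by field_simp
      rw [this]
      exact div_nonneg (mul_nonneg (by linarith) (by linarith)) (by linarith)
    linarith
  · rw [abs_of_nonpos (by linarith), abs_of_nonpos (Real.log_nonpos hd0.le h)]
    have := Real.log_le_sub_one_of_pos hd0
    linarith

/-- If positive numbers lie in `[m, M]`, then dividing their geometric mean by them gives numbers
in `[m / M, M / m]`. -/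
theorem geomMean_mem_Icc {n : ℕ} (hn : 0 < n) {μ : Fin n → ℝ} {m M g : ℝ} (hm : 0 < m)
    (h1 : ∀ j, m ≤ μ j) (h2 : ∀ j, μ j ≤ M) (hg0 : 0 < g) (hg : g ^ n = ∏ j, μ j) :
    m ≤ g ∧ g ≤ M := by
  have hM : 0 < M := hm.trans_le ((h1 ⟨0, hn⟩).trans (h2 _))
  constructor
  · refine le_of_pow_le_pow_left₀ hn.ne' hg0.le ?_
    rw [hg]
    calc m ^ n = ∏ _j : Fin n, m := by simp
      _ ≤ _ := Finset.prod_le_prod (fun _ _ => hm.le) fun j _ => h1 j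
  · refine le_of_pow_le_pow_left₀ hn.ne' hM.le ?_
    rw [hg]
    calc _ ≤ ∏ _j : Fin n, M := Finset.prod_le_prod (fun j _ => hm.le.trans (h1 j)) fun j _ => h2 j
      _ = M ^ n := by simp

/-- Bounds for the weighted row sums when the weights are close to `1`. -/
theorem sum_mul_mem_Icc {p n : ℕ} {c : Fin p → Fin n → ℝ}
    (hc : ∀ i j, 0 ≤ c i j) {s ε δ : ℝ} (hs : 0 ≤ s) (hε : ε ≤ δ) (hδ0 : 0 ≤ δ) (hδ : δ ≤ 1)
    (hrow : ∀ j, |∑ i, c i j - s / n| ≤ s * ε / n)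
    {d : Fin p → ℝ} (hd : ∀ i, |d i - 1| ≤ δ) (j : Fin n) :
    (1 - δ) * ((1 - δ) * (s / n)) ≤ ∑ i, c i j * d i ∧
      ∑ i, c i j * d i ≤ (1 + δ) * ((1 + δ) * (s / n)) := by
  set q : ℝ := s / n with hq
  have hq0 : 0 ≤ q := by positivity
  have hrow' : (1 - δ) * q ≤ ∑ i, c i j ∧ ∑ i, c i j ≤ (1 + δ) * q := by
    have e : s * ε / n = q * ε := by rw [hq]; ring
    have h := abs_le.1 (hrow j)
    rw [e] at h
    constructor <;> nlinarith
  constructor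
  · calc _ ≤ (1 - δ) * ∑ i, c i j := mul_le_mul_of_nonneg_left hrow'.1 (by linarith)
      _ ≤ _ := by
        rw [Finset.mul_sum]
        refine Finset.sum_le_sum fun i _ => ?_
        nlinarith [hc i j, (abs_le.1 (hd i)).1]
  · calc _ ≤ (1 + δ) * ∑ i, c i j := by
          rw [Finset.mul_sum]
          refine Finset.sum_le_sum fun i _ => ?_
          nlinarith [hc i j, (abs_le.1 (hd i)).2]
      _ ≤ _ := mul_le_mul_of_nonneg_left hrow'.2 (by linarith)

/-- Dividing the geometric mean of nearly equal positive numbers by one of them gives a number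
close to `1`. -/
theorem abs_geomMean_div_sub_one_le {n : ℕ} {q δ g : ℝ} (hq : 0 < q) (hδ0 : 0 ≤ δ)
    (hδ : δ ≤ 1 / 16) {μ : Fin n → ℝ}
    (h1 : ∀ j, (1 - δ) * ((1 - δ) * q) ≤ μ j) (h2 : ∀ j, μ j ≤ (1 + δ) * ((1 + δ) * q))
    (hg0 : 0 < g) (hg : g ^ n = ∏ j, μ j) (j : Fin n) :
    |g / μ j - 1| ≤ 6 * δ := by
  have hm : 0 < (1 - δ) * ((1 - δ) * q) :=
    mul_pos (by linarith) (mul_pos (by linarith) hq)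
  have hμ0 : 0 < μ j := hm.trans_le (h1 j)
  obtain ⟨h3, h4⟩ := geomMean_mem_Icc (Nat.zero_lt_of_lt j.2) hm h1 h2 hg0 hg
  -- The ratio of the two bounds is `((1 + δ) / (1 - δ))² = 1 + 4δ + O(δ²)`; the coefficient 6
  -- absorbs the remainder for `δ ≤ 1/16`.
  have hk : (1 + δ) * ((1 + δ) * q) ≤ (1 + 6 * δ) * ((1 - δ) * ((1 - δ) * q)) := by
    have : 0 ≤ δ * (2 - 12 * δ + 6 * δ ^ 2) := mul_nonneg hδ0 (by nlinarith)
    nlinarith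
  have hk' : (1 - 6 * δ) * ((1 + δ) * ((1 + δ) * q)) ≤ (1 - δ) * ((1 - δ) * q) := by
    have : 0 ≤ δ * (2 + 12 * δ + 6 * δ ^ 2) := mul_nonneg hδ0 (by nlinarith)
    nlinarith
  rw [abs_le]
  constructor
  · have : 1 - 6 * δ ≤ g / μ j := by
      rw [le_div_iff₀ hμ0]
      exact (mul_le_mul_of_nonneg_left (h2 j) (by linarith)).trans (hk'.trans h3)
    linarith
  · have : g / μ j ≤ 1 + 6 * δ := by
      rw [div_le_iff₀ hμ0]
      exact h4.trans (hk.trans (mul_le_mul_of_nonneg_left (h1 j) (by linarith)))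
    linarith

theorem neg_one_le_log {d : ℝ} (hd : |d - 1| ≤ 1 / 2) : -1 ≤ Real.log d := by
  have h := (abs_le.1 hd).1
  have hd0 : 0 < d := by linarith
  have h3 := Real.one_sub_inv_le_log_of_pos hd0
  have : d⁻¹ ≤ 2 := by
    rw [inv_le_comm₀ hd0 (by norm_num)]; linarith
  linarith

theorem one_lt_quadratic {r lam a b : ℝ} (hr : 0 < r) (hlam : 0 < lam) (hr2 : r ≤ 1 / 2)
    (ha : 16 * r ≤ a) :
    1 < 1 - r * lam * (a + b) + (lam - r * lam) / 4 * (a ^ 2 + b ^ 2) := by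
  -- The `b` part is at least `-2 r²` by completing the square, while the `a` part is at least `16
  -- r²` once `a ≥ 16 r`.
  have h1 : 0 < (a ^ 2 + b ^ 2) / 8 - r * (a + b) := by
    nlinarith [sq_nonneg (b - 4 * r), mul_nonneg (sub_nonneg.2 ha) (sub_nonneg.2 ha),
      mul_nonneg (sub_nonneg.2 ha) hr.le, mul_pos hr hr]
  have h2 := mul_pos hlam h1
  have h3 : 0 ≤ lam * ((1 / 2 - r) * ((a ^ 2 + b ^ 2) / 4)) :=
    mul_nonneg hlam.le (mul_nonneg (by linarith) (by positivity))
  linarith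

/-- In the sublevel set of the identity, a point of the `δ`-ball is in its interior. -/
theorem sum_sub_one_sq_lt {p n : ℕ} (hp : 0 < p) (hn : 0 < n) {c : Fin p → Fin n → ℝ}
    (hc : ∀ i j, 0 ≤ c i j) {s ε lam δ g : ℝ} (hs : 0 < s) (hε : 0 < ε) (hlam0 : 0 < lam)
    (hlam : lam ≤ 1) (hδ : δ = 32 * (ε * √p / lam)) (hδ1 : δ ≤ 1 / 16)
    (hsum : ∑ i, ∑ j, c i j = s)
    (hcol : ∀ i, |∑ j, c i j - s / p| ≤ s * ε / p) (hrow : ∀ j, |∑ i, c i j - s / n| ≤ s * ε / n)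
    (hcross : ∀ (x : Fin p → ℝ) (z : Fin n → ℝ), ∑ i, x i = 0 →
      -((1 - lam) * (s / √((n : ℝ) * p)) * √(∑ i, x i ^ 2) * √(∑ j, z j ^ 2)) ≤
        ∑ i, ∑ j, c i j * (x i * z j))
    {d : Fin p → ℝ} (hdprod : ∏ i, d i = 1) (hd : ∑ i, (d i - 1) ^ 2 ≤ δ ^ 2)
    {μ : Fin n → ℝ} (hμ : ∀ j, μ j = ∑ i, c i j * d i)
    (hg0 : 0 < g) (hg : g ^ n = ∏ j, μ j) (hgs : n * g ≤ s) :
    ∑ i, (d i - 1) ^ 2 < δ ^ 2 := by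
  have hp1 : (1 : ℝ) ≤ √p := Real.one_le_sqrt.2 (by exact_mod_cast hp)
  have hp0 : (0 : ℝ) < p := by exact_mod_cast hp
  have hn0 : (0 : ℝ) < n := by exact_mod_cast hn
  set r := ε / lam with hr
  have hr0 : 0 < r := by positivity
  have hεr : ε = r * lam := by rw [hr]; field_simp
  have hδr : δ = 32 * r * √p := by rw [hδ, hr]; ring
  have hδ0 : 0 < δ := by rw [hδr]; positivity
  have hrδ : 32 * r ≤ δ := by rw [hδr]; nlinarith
  have hεδ : ε ≤ δ := by rw [hεr]; nlinarith
  have hdi : ∀ i, |d i - 1| ≤ δ := fun i =>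
    abs_le_of_sq_le_sq ((Finset.single_le_sum (f := fun i => (d i - 1) ^ 2)
      (fun i _ => sq_nonneg _) (Finset.mem_univ i)).trans hd) hδ0.le
  have hd2 : ∀ i, |d i - 1| ≤ 1 / 2 := fun i => (hdi i).trans (by linarith)
  have hdpos : ∀ i, 0 < d i := fun i => by linarith [(abs_le.1 (hd2 i)).1]
  have hμb := fun j => sum_mul_mem_Icc hc hs.le hεδ hδ0.le (by linarith) hrow hdi j
  simp only [← hμ] at hμb
  have hq0 : 0 < s / n := by positivity
  have hμ0 : ∀ j, 0 < μ j := fun j =>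
    (mul_pos (by linarith) (mul_pos (by linarith) hq0)).trans_le (hμb j).1
  have hy := abs_geomMean_div_sub_one_le hq0 hδ0.le hδ1 (fun j => (hμb j).1)
    (fun j => (hμb j).2) hg0 hg
  have hypos : ∀ j, 0 < g / μ j := fun j => div_pos hg0 (hμ0 j)
  -- Assume the point lies on the boundary sphere; the exponential sum will then exceed `s`.
  by_contra! hcon
  set x : Fin p → ℝ := fun i => Real.log (d i) with hxdef
  set z : Fin n → ℝ := fun j => Real.log (g / μ j) with hzdef
  have hx : ∑ i, x i = 0 := by
    rw [hxdef, ← Real.log_prod (fun i _ => (hdpos i).ne'), hdprod, Real.log_one]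
  have hz : ∑ j, z j = 0 := by
    rw [hzdef, ← Real.log_prod (fun j _ => (hypos j).ne'), Finset.prod_div_distrib, ← hg]
    simp [hg0.ne']
  set a := √((∑ i, x i ^ 2) / p) with ha
  set b := √((∑ j, z j ^ 2) / n) with hb
  have hxa : ∑ i, x i ^ 2 = p * a ^ 2 := by
    rw [ha, Real.sq_sqrt (by positivity)]; field_simp
  have hzb : ∑ j, z j ^ 2 = n * b ^ 2 := by
    rw [hb, Real.sq_sqrt (by positivity)]; field_simp
  have ha0 : 0 ≤ a := Real.sqrt_nonneg _
  have hb0 : 0 ≤ b := Real.sqrt_nonneg _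
  -- The factor `√(n p)` in the gap hypothesis is exactly what turns `ℓ²` norms into root mean
  -- squares.
  have hcr : -((1 - lam) * s * (a * b)) ≤ ∑ i, ∑ j, c i j * (x i * z j) := by
    refine le_trans (le_of_eq ?_) (hcross x z hx)
    rw [ha, hb, Real.sqrt_div (by positivity), Real.sqrt_div (by positivity),
      Real.sqrt_mul hn0.le]
    field_simp
  have hlow : ∀ i j, -2 ≤ x i + z j := fun i j => by
    have h1 := neg_one_le_log (hd2 i)
    have h2 := neg_one_le_log ((hy j).trans (by linarith : 6 * δ ≤ 1 / 2))
    simp only [hxdef, hzdef]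
    linarith
  have key := le_sum_mul_exp_add hp hn hc hs hlam hsum hcol hrow hx hz ha0 hb0 hxa hzb hlow hcr
  -- Summing over `i` first gives `(g / μ j) * μ j = g` for each `j`.
  have hval : ∑ i, ∑ j, c i j * Real.exp (x i + z j) = n * g := by
    have : ∀ i j, c i j * Real.exp (x i + z j) = g / μ j * (c i j * d i) := fun i j => by
      simp only [hxdef, hzdef]
      rw [Real.exp_add, Real.exp_log (hdpos i), Real.exp_log (hypos j)]; ring
    simp only [this]
    rw [Finset.sum_comm]
    simp only [← Finset.mul_sum, ← hμ]
    rw [Finset.sum_congr rfl fun j _ => div_mul_cancel₀ g (hμ0 j).ne']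
    simp
  rw [hval] at key
  -- Here `δ² ≤ 4 p a²` and `δ = 32 r √p`; the 32 is twice the 16 that `one_lt_quadratic` requires.
  have hax : 16 * r ≤ a := by
    have h1 : ∑ i, (d i - 1) ^ 2 ≤ 4 * ∑ i, x i ^ 2 := by
      rw [Finset.mul_sum]
      refine Finset.sum_le_sum fun i _ => ?_
      have := abs_sub_one_le_two_mul_abs_log (hd2 i)
      rw [← sq_abs, ← sq_abs (x i)]
      nlinarith [abs_nonneg (d i - 1), abs_nonneg (x i)]
    rw [hxa] at h1
    have h2 : δ ^ 2 = 1024 * r ^ 2 * p := by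
      rw [hδr, mul_pow, mul_pow, Real.sq_sqrt hp0.le]; norm_num
    have h3 : (p : ℝ) * (1024 * r ^ 2) ≤ p * (4 * a ^ 2) := by linarith
    have h4 := le_of_mul_le_mul_left h3 hp0
    have h5 : (16 * r) ^ 2 ≤ a ^ 2 := by linarith [mul_pow 16 r 2]
    exact (abs_le_of_sq_le_sq' h5 ha0).2
  have hfin : 1 - ε * (a + b) + (lam - ε) / 4 * (a ^ 2 + b ^ 2) ≤ 1 :=
    le_of_mul_le_mul_left (by linarith) hs
  rw [hεr] at hfin
  exact (one_lt_quadratic hr0 hlam0 (by linarith) hax).not_ge hfin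

/-! ### Functional calculus in a fixed eigenbasis -/

open scoped ComplexOrder

/-- The Hermitian matrix `U * diag(d) * Uᴴ`. -/
def conjDiag {m : ℕ} (U : Matrix (Fin m) (Fin m) ℂ) (d : Fin m → ℝ) : Matrix (Fin m) (Fin m) ℂ :=
  U * Matrix.diagonal (fun i => (d i : ℂ)) * Uᴴ

section ConjDiag

variable {m : ℕ} {U : Matrix (Fin m) (Fin m) ℂ}

theorem _root_.Matrix.IsHermitian.exists_eq_conjDiag {H : Matrix (Fin m) (Fin m) ℂ}
    (hH : H.IsHermitian) :
    ∃ (U : Matrix (Fin m) (Fin m) ℂ) (d : Fin m → ℝ), Uᴴ * U = 1 ∧ H = conjDiag U d := by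
  refine ⟨hH.eigenvectorUnitary, hH.eigenvalues, ?_, ?_⟩
  · exact Unitary.coe_star_mul_self hH.eigenvectorUnitary
  · conv_lhs => rw [hH.spectral_theorem, Unitary.conjStarAlgAut_apply]
    rfl

theorem conjDiag_mul (hU : Uᴴ * U = 1) (d e : Fin m → ℝ) :
    conjDiag U d * conjDiag U e = conjDiag U (fun i => d i * e i) := by
  simp only [conjDiag, Complex.ofReal_mul, ← Matrix.diagonal_mul_diagonal]
  calc _ = U * Matrix.diagonal (fun i => (d i : ℂ)) * (Uᴴ * U) *
        Matrix.diagonal (fun i => (e i : ℂ)) * Uᴴ := by simp only [Matrix.mul_assoc]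
    _ = _ := by rw [hU, Matrix.mul_one]; simp only [Matrix.mul_assoc]

theorem conjDiag_const (hU : Uᴴ * U = 1) (k : ℝ) :
    conjDiag U (fun _ => k) = (k : ℂ) • (1 : Matrix (Fin m) (Fin m) ℂ) := by
  rw [conjDiag, show Matrix.diagonal (fun _ : Fin m => (k : ℂ)) =
    (k : ℂ) • (1 : Matrix (Fin m) (Fin m) ℂ) by ext i j; simp [Matrix.diagonal, Matrix.one_apply]]
  simp [mul_eq_one_comm.1 hU]

theorem conjDiag_sub (d e : Fin m → ℝ) :
    conjDiag U d - conjDiag U e = conjDiag U (fun i => d i - e i) := by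
  simp only [conjDiag, ← Matrix.sub_mul, ← Matrix.mul_sub, Matrix.diagonal_sub, Complex.ofReal_sub]

theorem conjDiag_sub_one (hU : Uᴴ * U = 1) (d : Fin m → ℝ) :
    conjDiag U d - 1 = conjDiag U (fun i => d i - 1) := by
  rw [← conjDiag_sub, conjDiag_const hU]; simp

theorem conjDiag_eq_sum (d : Fin m → ℝ) :
    conjDiag U d = ∑ i, (d i : ℂ) • conjDiag U (Pi.single i 1) := by
  have : Matrix.diagonal (fun i => (d i : ℂ)) =
      ∑ i, (d i : ℂ) • Matrix.diagonal (fun j => ((Pi.single i 1 : Fin m → ℝ) j : ℂ)) := by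
    ext a b
    rw [Matrix.sum_apply]
    by_cases h : a = b
    · subst h
      simp [Pi.single_apply, apply_ite Complex.ofReal]
    · simp [h]
  rw [conjDiag, this]
  simp [conjDiag, Matrix.mul_sum, Matrix.sum_mul]

theorem posSemidef_conjDiag {d : Fin m → ℝ} (hd : ∀ i, 0 ≤ d i) : (conjDiag U d).PosSemidef := by
  refine Matrix.PosSemidef.mul_mul_conjTranspose_same ?_ U
  exact Matrix.PosSemidef.diagonal fun i => by simpa using hd i

theorem isHermitian_conjDiag (d : Fin m → ℝ) : (conjDiag U d).IsHermitian := by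
  rw [Matrix.IsHermitian, conjDiag, Matrix.conjTranspose_mul, Matrix.conjTranspose_mul,
    Matrix.conjTranspose_conjTranspose, Matrix.diagonal_conjTranspose, Matrix.mul_assoc]
  congr 3
  ext i; simp

theorem trace_conjDiag (hU : Uᴴ * U = 1) (d : Fin m → ℝ) :
    (conjDiag U d).trace = ((∑ i, d i : ℝ) : ℂ) := by
  rw [conjDiag, Matrix.trace_mul_comm, ← Matrix.mul_assoc, hU]
  simp

theorem det_conjDiag (hU : Uᴴ * U = 1) (d : Fin m → ℝ) :
    (conjDiag U d).det = ((∏ i, d i : ℝ) : ℂ) := by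
  have h := congrArg Matrix.det hU
  rw [Matrix.det_mul, Matrix.det_one] at h
  rw [conjDiag, Matrix.det_mul, Matrix.det_mul, Matrix.det_diagonal]
  push_cast
  linear_combination (∏ i, (d i : ℂ)) * h

theorem continuous_conjDiag : Continuous (conjDiag U) := by
  unfold conjDiag
  fun_prop

/-! ### Frobenius and operator norms in an eigenbasis -/

theorem frobNorm_eq (M : Matrix (Fin m) (Fin m) ℂ) :
    frobNorm M = √(∑ i, ∑ j, ‖M i j‖ ^ 2) := by
  have h := @Matrix.frobenius_norm_def _ _ ℂ _ _ _ M
  simp only [Real.rpow_two, ← Real.sqrt_eq_rpow] at h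
  exact h

theorem continuous_frobNorm : Continuous (frobNorm (m := m)) := by
  have : frobNorm (m := m) = fun M => √(∑ i, ∑ j, ‖M i j‖ ^ 2) := funext frobNorm_eq
  rw [this]
  fun_prop

theorem frobNorm_conjDiag (hU : Uᴴ * U = 1) (d : Fin m → ℝ) :
    frobNorm (conjDiag U d) = √(∑ i, d i ^ 2) := by
  rw [frobNorm_eq]
  congr 1
  have h1 : ((conjDiag U d)ᴴ * conjDiag U d).trace =
      ((∑ i, ∑ j, ‖conjDiag U d i j‖ ^ 2 : ℝ) : ℂ) := by
    rw [Finset.sum_comm]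
    simp [Matrix.trace, Matrix.mul_apply, Complex.conj_mul']
  rw [(isHermitian_conjDiag d).eq, conjDiag_mul hU, trace_conjDiag hU] at h1
  rw [← Complex.ofReal_inj.1 h1]
  simp only [sq]

theorem abs_re_trace_mul_le (A B : Matrix (Fin m) (Fin m) ℂ) :
    |(Aᴴ * B).trace.re| ≤ frobNorm A * frobNorm B := by
  have h1 : (Aᴴ * B).trace = ∑ x : Fin m × Fin m, star (A x.2 x.1) * B x.2 x.1 := by
    simp [Matrix.trace, Matrix.mul_apply, Fintype.sum_prod_type]
  have h2 : ∀ M : Matrix (Fin m) (Fin m) ℂ,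
      frobNorm M = √(∑ x : Fin m × Fin m, ‖M x.2 x.1‖ ^ 2) := fun M => by
    rw [frobNorm_eq, Finset.sum_comm, Fintype.sum_prod_type]
  rw [h2, h2]
  refine (Complex.abs_re_le_norm _).trans ?_
  rw [h1]
  refine (norm_sum_le _ _).trans ?_
  simp only [norm_mul, norm_star]
  exact Real.sum_mul_le_sqrt_mul_sqrt _ _ _

section OpNorm

open scoped Matrix.Norms.L2Operator

theorem opNorm_eq_norm (M : Matrix (Fin m) (Fin m) ℂ) : opNorm M = ‖M‖ := rfl

theorem mem_unitary_of_conjTranspose_mul (hU : Uᴴ * U = 1) :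
    U ∈ unitary (Matrix (Fin m) (Fin m) ℂ) :=
  ⟨hU, mul_eq_one_comm.1 hU⟩

theorem opNorm_conjDiag_le (hU : Uᴴ * U = 1) {d : Fin m → ℝ} {t : ℝ} (ht : 0 ≤ t)
    (hd : ∀ i, |d i| ≤ t) : opNorm (conjDiag U d) ≤ t := by
  have hu := mem_unitary_of_conjTranspose_mul hU
  rw [opNorm_eq_norm, conjDiag, ← Matrix.star_eq_conjTranspose,
    CStarRing.norm_mul_mem_unitary _ (Unitary.star_mem hu), CStarRing.norm_mem_unitary_mul _ hu,
    Matrix.l2_opNorm_diagonal]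
  exact (pi_norm_le_iff_of_nonneg ht).2 fun i => by simpa using hd i

theorem norm_apply_le_opNorm (M : Matrix (Fin m) (Fin m) ℂ) (i j : Fin m) :
    ‖M i j‖ ≤ opNorm M := by
  have h := (Matrix.toEuclideanCLM (n := Fin m) (𝕜 := ℂ) M).le_opNorm
    (EuclideanSpace.single j 1)
  have h2 := PiLp.norm_apply_le (Matrix.toEuclideanCLM (n := Fin m) (𝕜 := ℂ) M
    (EuclideanSpace.single j 1)) i
  simpa [Matrix.ofLp_toEuclideanCLM, opNorm] using h2.trans h

/-- The trace is a diagonal entry of `Uᴴ * B * U`, whose operator norm is that of `B`. This turns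
the balance conditions into bounds on row and column sums in any orthonormal bases. -/
theorem abs_re_trace_conjDiag_single_mul_le (hU : Uᴴ * U = 1) (j : Fin m)
    (B : Matrix (Fin m) (Fin m) ℂ) :
    |(conjDiag U (Pi.single j 1) * B).trace.re| ≤ opNorm B := by
  have hu := mem_unitary_of_conjTranspose_mul hU
  have h1 : (conjDiag U (Pi.single j 1) * B).trace = (Uᴴ * B * U) j j := by
    rw [conjDiag, Matrix.mul_assoc, Matrix.mul_assoc, Matrix.trace_mul_comm, Matrix.mul_assoc,
      Matrix.trace]
    simp [Matrix.diagonal_mul, Pi.single_apply, apply_ite Complex.ofReal]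
  have h2 : opNorm (Uᴴ * B * U) = opNorm B := by
    rw [opNorm_eq_norm, ← Matrix.star_eq_conjTranspose, CStarRing.norm_mul_mem_unitary _ hu,
      CStarRing.norm_mem_unitary_mul _ (Unitary.star_mem hu), opNorm_eq_norm]
  rw [h1, ← h2]
  exact (Complex.abs_re_le_norm _).trans (norm_apply_le_opNorm _ _ _)

end OpNorm

theorem re_trace_conjDiag_single_mul_conjDiag (hU : Uᴴ * U = 1) (j : Fin m) (d : Fin m → ℝ) :
    (conjDiag U (Pi.single j 1) * conjDiag U d).trace.re = d j := by
  rw [conjDiag_mul hU, trace_conjDiag hU]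
  simp [Pi.single_apply]

/-! ### Positive matrices: square roots, AM-GM and first-order optimality -/

theorem _root_.Matrix.PosSemidef.exists_isHermitian_mul_self {P : Matrix (Fin m) (Fin m) ℂ}
    (hP : P.PosSemidef) : ∃ S : Matrix (Fin m) (Fin m) ℂ, S.PosSemidef ∧ S * S = P := by
  obtain ⟨U, d, hU, rfl⟩ := hP.isHermitian.exists_eq_conjDiag
  have hd : ∀ i, 0 ≤ d i := fun i => by
    have h := hP.conjTranspose_mul_mul_same U |>.diag_nonneg (i := i)
    have e : Uᴴ * conjDiag U d * U = Matrix.diagonal (fun i => (d i : ℂ)) := by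
      calc _ = Uᴴ * U * Matrix.diagonal (fun i => (d i : ℂ)) * (Uᴴ * U) := by
            simp only [conjDiag, Matrix.mul_assoc]
        _ = _ := by simp [hU]
    rw [e] at h
    simpa using h
  refine ⟨conjDiag U (fun i => √(d i)), posSemidef_conjDiag fun i => Real.sqrt_nonneg _, ?_⟩
  rw [conjDiag_mul hU]
  simp only [Real.mul_self_sqrt (hd _)]

theorem re_trace_mul_nonneg {A B : Matrix (Fin m) (Fin m) ℂ} (hA : A.PosSemidef)
    (hB : B.PosSemidef) : 0 ≤ (A * B).trace.re := by
  obtain ⟨S, hS, rfl⟩ := hA.exists_isHermitian_mul_self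
  rw [Matrix.mul_assoc, Matrix.trace_mul_comm]
  have h := (hB.mul_mul_conjTranspose_same S).trace_nonneg
  rw [hS.isHermitian.eq] at h
  exact (Complex.nonneg_iff.1 h).1

theorem nonneg_of_posSemidef_conjDiag (hU : Uᴴ * U = 1) {d : Fin m → ℝ}
    (h : (conjDiag U d).PosSemidef) (i : Fin m) : 0 ≤ d i := by
  rw [← re_trace_conjDiag_single_mul_conjDiag hU i d]
  refine re_trace_mul_nonneg (posSemidef_conjDiag fun j => ?_) h
  by_cases hj : j = i
  · simp [hj]
  · simp [hj]

theorem posSemidef_conjDiag_single (i : Fin m) : (conjDiag U (Pi.single i 1)).PosSemidef :=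
  posSemidef_conjDiag fun j => (Pi.single_nonneg (α := fun _ : Fin m => ℝ)).2 zero_le_one j

/-- A square root of a positive matrix of determinant one. -/
theorem exists_sqrt_of_det_eq_one {P : Matrix (Fin m) (Fin m) ℂ}
    (hP : P.PosSemidef) (hdet : P.det = 1) :
    ∃ S : Matrix (Fin m) (Fin m) ℂ, S.PosSemidef ∧ S.det = 1 ∧ S * S = P := by
  obtain ⟨S, hS, rfl⟩ := hP.exists_isHermitian_mul_self
  refine ⟨S, hS, ?_, rfl⟩
  rw [Matrix.det_mul] at hdet
  rcases mul_self_eq_one_iff.1 hdet with h | h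
  · exact h
  · have := (Complex.nonneg_iff.1 hS.det_nonneg).1
    rw [h] at this
    norm_num at this

/-- The arithmetic-geometric mean inequality `n (det M)^(1/n) ≤ tr (Y M)` for `det Y = 1`. -/
theorem mul_le_re_trace_mul {Y M : Matrix (Fin m) (Fin m) ℂ} (hY : Y.PosSemidef)
    (hYdet : Y.det = 1) (hM : M.PosSemidef) {g : ℝ} (hgM : g ^ m ≤ M.det.re) :
    m * g ≤ (Y * M).trace.re := by
  rcases Nat.eq_zero_or_pos m with rfl | hm
  · simp [Matrix.trace]
  -- Conjugation by `S = √Y` reduces to scalar AM-GM for the eigenvalues of `S * M * S`, which has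
  -- the determinant of `M` and trace `tr (Y M)`.
  obtain ⟨S, hS, hSdet, rfl⟩ := exists_sqrt_of_det_eq_one hY hYdet
  have hN := hM.mul_mul_conjTranspose_same S
  rw [hS.isHermitian.eq] at hN
  have h1 : (S * S * M).trace = (S * M * S).trace := by
    rw [Matrix.mul_assoc, Matrix.trace_mul_comm]
  have h2 : (S * M * S).det = M.det := by simp [Matrix.det_mul, hSdet]
  rw [h1]
  rw [← h2] at hgM
  obtain ⟨U, ν, hU, hν⟩ := hN.isHermitian.exists_eq_conjDiag
  rw [hν] at hN hgM ⊢
  have hν0 := nonneg_of_posSemidef_conjDiag hU hN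
  rw [det_conjDiag hU, Complex.ofReal_re] at hgM
  rw [trace_conjDiag hU, Complex.ofReal_re]
  have hm0 : (0 : ℝ) < m := by exact_mod_cast hm
  have h3 := Real.geom_mean_le_arith_mean_weighted Finset.univ (fun _ => (m : ℝ)⁻¹) ν
    (fun _ _ => by positivity) (by simp [hm0.ne']) fun i _ => hν0 i
  rw [← Finset.mul_sum] at h3
  have h4 : g ≤ ∏ i, ν i ^ (m : ℝ)⁻¹ := by
    refine le_of_pow_le_pow_left₀ hm.ne' (Finset.prod_nonneg fun i _ => Real.rpow_nonneg (hν0 i) _)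
      (hgM.trans (le_of_eq ?_))
    rw [← Finset.prod_pow]
    refine Finset.prod_congr rfl fun i _ => ?_
    rw [Real.rpow_inv_natCast_pow (hν0 i) hm.ne']
  calc (m : ℝ) * g ≤ m * ((m : ℝ)⁻¹ * ∑ i, ν i) := mul_le_mul_of_nonneg_left (h4.trans h3) hm0.le
    _ = _ := by field_simp

/-- First-order optimality: a local minimum at `1` of the functional `Q ↦ tr (W Q)` on positive
matrices of determinant one forces `W` to be scalar. -/
theorem exists_eq_smul_one_of_isLocalMin {W : Matrix (Fin m) (Fin m) ℂ} (hW : W.IsHermitian)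
    (hmin : ∀ᶠ Q in nhds (1 : Matrix (Fin m) (Fin m) ℂ), Q.PosSemidef → Q.det = 1 →
      W.trace.re ≤ (W * Q).trace.re) : ∃ k : ℝ, W = (k : ℂ) • 1 := by
  obtain ⟨U, w, hU, rfl⟩ := hW.exists_eq_conjDiag
  have key : ∀ i j, i ≠ j → w j ≤ w i := by
    -- Multiply the `i`-th eigenvalue of the identity by `1 + t` and divide the `j`-th by it,
    -- preserving the determinant. After division by `t > 0`, minimality reads `w j ≤ w i * (1 +
    -- t)`; let `t → 0`.
    intro i j hij
    set q : ℝ → Fin m → ℝ := fun t k => if k = i then 1 + t else if k = j then (1 + t)⁻¹ else 1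
      with hq
    have hq0 : q 0 = fun _ => 1 := by funext k; simp [hq]
    have hcont : Filter.Tendsto (fun t => conjDiag U (q t)) (nhds 0)
        (nhds (1 : Matrix (Fin m) (Fin m) ℂ)) := by
      have h1 : ContinuousAt q 0 := by
        refine continuousAt_pi.2 fun k => ?_
        simp only [hq]
        split_ifs
        · fun_prop
        · exact ContinuousAt.inv₀ (by fun_prop) (by norm_num)
        · fun_prop
      have h2 : ContinuousAt (fun t => conjDiag U (q t)) 0 :=
        continuous_conjDiag.continuousAt.comp h1
      have h3 : conjDiag U (q 0) = 1 := by rw [hq0, conjDiag_const hU]; simp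
      rw [← h3]
      exact h2
    have hev : ∀ᶠ t in nhdsWithin (0 : ℝ) (Set.Ioi 0), w j ≤ w i * (1 + t) := by
      filter_upwards [(hcont.eventually hmin).filter_mono nhdsWithin_le_nhds,
        self_mem_nhdsWithin] with t ht ht0
      have ht0 : 0 < t := ht0
      have hqpos : ∀ k, 0 ≤ q t k := fun k => by
        simp only [hq]; split_ifs <;> positivity
      have hsplit : ∀ (f : Fin m → ℝ), (∀ k, k ≠ i → k ≠ j → f k = 0) →
          ∑ k, f k = f i + f j := fun f hf => by
        rw [← Finset.sum_pair hij]
        refine (Finset.sum_subset (Finset.subset_univ _) fun k _ hk => ?_).symm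
        simp only [Finset.mem_insert, Finset.mem_singleton, not_or] at hk
        exact hf k hk.1 hk.2
      have hdet : (conjDiag U (q t)).det = 1 := by
        rw [det_conjDiag hU]
        have : ∏ k, q t k = q t i * q t j := by
          rw [← Finset.prod_pair hij]
          refine (Finset.prod_subset (Finset.subset_univ _) fun k _ hk => ?_).symm
          simp only [Finset.mem_insert, Finset.mem_singleton, not_or] at hk
          simp [hq, hk.1, hk.2]
        rw [this]
        simp only [hq, if_true, if_neg hij.symm]
        rw [mul_inv_cancel₀ (by positivity)]
        simp
      have h := ht (posSemidef_conjDiag hqpos) hdet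
      rw [conjDiag_mul hU, trace_conjDiag hU, trace_conjDiag hU, Complex.ofReal_re,
        Complex.ofReal_re, ← sub_nonneg, ← Finset.sum_sub_distrib, hsplit] at h
      · simp only [hq, if_true, if_neg hij.symm] at h
        have h5 : w i * (1 + t) - w i + (w j * (1 + t)⁻¹ - w j) =
            t * (1 + t)⁻¹ * (w i * (1 + t) - w j) := by
          field_simp; ring
        rw [h5] at h
        have := nonneg_of_mul_nonneg_right h (by positivity)
        linarith
      · intro k hk1 hk2
        simp [hq, hk1, hk2]
    have hlim : Filter.Tendsto (fun t : ℝ => w i * (1 + t)) (nhdsWithin (0 : ℝ) (Set.Ioi 0))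
        (nhds (w i)) := by
      have : ContinuousAt (fun t : ℝ => w i * (1 + t)) 0 := by fun_prop
      have h := this.tendsto
      simp only [add_zero, mul_one] at h
      exact h.mono_left nhdsWithin_le_nhds
    exact ge_of_tendsto hlim hev
  rcases Nat.eq_zero_or_pos m with rfl | hm
  · exact ⟨0, Subsingleton.elim _ _⟩
  · refine ⟨w ⟨0, hm⟩, ?_⟩
    rw [← conjDiag_const hU]
    congr 1
    funext k
    by_cases hk : k = ⟨0, hm⟩
    · rw [hk]
    · exact le_antisymm (key _ _ (Ne.symm hk)) (key _ _ hk)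

end ConjDiag

/-! ### Completely positive maps and their weight matrices -/

section Positive

variable {p n : ℕ} {Φ : Matrix (Fin p) (Fin p) ℂ →ₗ[ℂ] Matrix (Fin n) (Fin n) ℂ}

theorem IsCompletelyPositive.posSemidef (hΦ : IsCompletelyPositive Φ)
    {P : Matrix (Fin p) (Fin p) ℂ} (hP : P.PosSemidef) : (Φ P).PosSemidef := by
  obtain ⟨r, A, rfl⟩ := hΦ
  exact Matrix.posSemidef_sum _ fun i _ => hP.mul_mul_conjTranspose_same (A i)

theorem IsCompletelyPositive.posSemidef_dual (hΦ : IsCompletelyPositive Φ)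
    {Y : Matrix (Fin n) (Fin n) ℂ} (hY : Y.PosSemidef) : (dual Φ Y).PosSemidef := by
  obtain ⟨r, A, rfl⟩ := hΦ
  rw [dual_krausMap]
  exact Matrix.posSemidef_sum _ fun i _ => hY.conjTranspose_mul_mul_same (A i)

theorem IsCompletelyPositive.trace_dual_mul (hΦ : IsCompletelyPositive Φ)
    {P : Matrix (Fin p) (Fin p) ℂ} (hP : P.PosSemidef) (Y : Matrix (Fin n) (Fin n) ℂ) :
    (dual Φ Y * P).trace = (Y * Φ P).trace := by
  have h := trace_conjTranspose_mul_dual Φ P Y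
  rw [hP.isHermitian.eq, (hΦ.posSemidef hP).isHermitian.eq] at h
  rw [Matrix.trace_mul_comm, h, Matrix.trace_mul_comm]

theorem scaling_krausMap {r : ℕ} (A : Fin r → Matrix (Fin n) (Fin p) ℂ)
    (L : Matrix (Fin p) (Fin p) ℂ) (R : Matrix (Fin n) (Fin n) ℂ) :
    scaling (krausMap A) L R = krausMap fun i => R * A i * Lᴴ := by
  ext1 X
  simp [scaling, krausMap, Matrix.mul_sum, Matrix.sum_mul, Matrix.mul_assoc]

theorem IsCompletelyPositive.dual_scaling (hΦ : IsCompletelyPositive Φ)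
    (L : Matrix (Fin p) (Fin p) ℂ) (R Y : Matrix (Fin n) (Fin n) ℂ) :
    dual (scaling Φ L R) Y = L * dual Φ (Rᴴ * Y * R) * Lᴴ := by
  obtain ⟨r, A, rfl⟩ := hΦ
  rw [scaling_krausMap, dual_krausMap, dual_krausMap]
  simp [Matrix.mul_sum, Matrix.sum_mul, Matrix.mul_assoc]

/-- The nonnegative matrix representing `Φ` in a pair of orthonormal bases. -/
def weight (Φ : Matrix (Fin p) (Fin p) ℂ →ₗ[ℂ] Matrix (Fin n) (Fin n) ℂ)
    (U : Matrix (Fin p) (Fin p) ℂ) (V : Matrix (Fin n) (Fin n) ℂ) (i : Fin p) (j : Fin n) : ℝ :=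
  (conjDiag V (Pi.single j 1) * Φ (conjDiag U (Pi.single i 1))).trace.re

variable {U : Matrix (Fin p) (Fin p) ℂ} {V : Matrix (Fin n) (Fin n) ℂ}

theorem re_trace_conjDiag_mul_map (d : Fin p → ℝ) (e : Fin n → ℝ) :
    (conjDiag V e * Φ (conjDiag U d)).trace.re = ∑ i, ∑ j, weight Φ U V i j * (d i * e j) := by
  rw [conjDiag_eq_sum (U := U) d, conjDiag_eq_sum (U := V) e]
  simp only [map_sum, map_smul, Matrix.mul_sum, Matrix.sum_mul, Matrix.mul_smul, Matrix.smul_mul,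
    Matrix.trace_sum, Matrix.trace_smul, smul_eq_mul, Complex.re_sum, Complex.re_ofReal_mul, weight]
  refine Finset.sum_congr rfl fun i _ => ?_
  rw [Finset.mul_sum]
  refine Finset.sum_congr rfl fun j _ => ?_
  ring

theorem IsCompletelyPositive.weight_nonneg (hΦ : IsCompletelyPositive Φ) (i : Fin p) (j : Fin n) :
    0 ≤ weight Φ U V i j :=
  re_trace_mul_nonneg (posSemidef_conjDiag_single j) (hΦ.posSemidef (posSemidef_conjDiag_single i))

theorem sum_weight_eq (hU : Uᴴ * U = 1) (j : Fin n) :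
    ∑ i, weight Φ U V i j = (conjDiag V (Pi.single j 1) * Φ 1).trace.re := by
  have h := re_trace_conjDiag_mul_map (Φ := Φ) (U := U) (V := V) (fun _ => 1) (Pi.single j 1)
  rw [conjDiag_const hU] at h
  simp only [Complex.ofReal_one, one_smul, one_mul] at h
  rw [h]
  exact Finset.sum_congr rfl fun i _ => by simp [Pi.single_apply]

theorem sum_weight_eq' (hV : Vᴴ * V = 1) (i : Fin p) :
    ∑ j, weight Φ U V i j = (1 * Φ (conjDiag U (Pi.single i 1))).trace.re := by
  have h := re_trace_conjDiag_mul_map (Φ := Φ) (U := U) (V := V) (Pi.single i 1) (fun _ => 1)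
  rw [conjDiag_const hV] at h
  simp only [Complex.ofReal_one, one_smul, mul_one] at h
  rw [h, Finset.sum_comm]
  exact Finset.sum_congr rfl fun j _ => by simp [Pi.single_apply]

theorem sum_sum_weight (hU : Uᴴ * U = 1) (hV : Vᴴ * V = 1) :
    ∑ i, ∑ j, weight Φ U V i j = size Φ := by
  have h := re_trace_conjDiag_mul_map (Φ := Φ) (U := U) (V := V) (fun _ => 1) (fun _ => 1)
  rw [conjDiag_const hV, conjDiag_const hU] at h
  simpa [size] using h.symm

theorem abs_re_trace_conjDiag_single_mul_sub_le {m : ℕ} {U B : Matrix (Fin m) (Fin m) ℂ}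
    (hU : Uᴴ * U = 1) {q t : ℝ} (hB : opNorm (B - (q : ℂ) • 1) ≤ t) (j : Fin m) :
    |(conjDiag U (Pi.single j 1) * B).trace.re - q| ≤ t := by
  have h := (abs_re_trace_conjDiag_single_mul_le hU j (B - (q : ℂ) • 1)).trans hB
  rw [Matrix.mul_sub, Matrix.trace_sub, Complex.sub_re] at h
  simpa [trace_conjDiag hU, Pi.single_apply] using h

theorem IsEpsDoublyBalanced.abs_sum_weight_sub_le {ε : ℝ} (h : IsEpsDoublyBalanced ε Φ)
    (hU : Uᴴ * U = 1) (hV : Vᴴ * V = 1) (j : Fin n) :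
    |∑ i, weight Φ U V i j - size Φ / n| ≤ size Φ * ε / n := by
  rw [sum_weight_eq hU]
  exact abs_re_trace_conjDiag_single_mul_sub_le hV h.1 j

theorem IsEpsDoublyBalanced.abs_sum_weight_sub_le' {ε : ℝ} (h : IsEpsDoublyBalanced ε Φ)
    (hΦ : IsCompletelyPositive Φ) (hU : Uᴴ * U = 1) (hV : Vᴴ * V = 1) (i : Fin p) :
    |∑ j, weight Φ U V i j - size Φ / p| ≤ size Φ * ε / p := by
  rw [sum_weight_eq' hV, ← hΦ.trace_dual_mul (posSemidef_conjDiag_single i), Matrix.trace_mul_comm]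
  exact abs_re_trace_conjDiag_single_mul_sub_le hU h.2 i

/-- The double sum is `tr (Z Φ(X))` for Hermitian `X`, `Z` with spectra `x`, `z`, so Cauchy-Schwarz
and the spectral gap apply. Only `X` has to be traceless. -/
theorem IsQuantumExpander.neg_le_sum_weight_mul {ε lam : ℝ} (h : IsQuantumExpander ε (1 - lam) Φ)
    (hU : Uᴴ * U = 1) (hV : Vᴴ * V = 1) (x : Fin p → ℝ) (z : Fin n → ℝ) (hx : ∑ i, x i = 0) :
    -((1 - lam) * (size Φ / √((n : ℝ) * p)) * √(∑ i, x i ^ 2) * √(∑ j, z j ^ 2)) ≤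
      ∑ i, ∑ j, weight Φ U V i j * (x i * z j) := by
  rw [← re_trace_conjDiag_mul_map]
  have h1 := abs_re_trace_mul_le (conjDiag V z) (Φ (conjDiag U x))
  rw [(isHermitian_conjDiag z).eq] at h1
  have h2 := h.2.2 (conjDiag U x) (isHermitian_conjDiag x) (by rw [trace_conjDiag hU, hx]; simp)
  rw [frobNorm_conjDiag hU] at h2
  rw [frobNorm_conjDiag hV] at h1
  have h3 := mul_le_mul_of_nonneg_left h2 (Real.sqrt_nonneg (∑ j, z j ^ 2))
  have h4 := (abs_le.1 h1).1
  linarith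

/-! ### Expanders near the identity -/

/-- The diagonalised data attached to a positive matrix near the identity. -/
theorem IsQuantumExpander.exists_diagonalization {ε lam δ : ℝ}
    (h : IsQuantumExpander ε (1 - lam) Φ) (hs : 0 < size Φ) (hn : 0 < n) (hε : ε ≤ δ)
    (hδ0 : 0 ≤ δ) (hδ : δ ≤ 1 / 16) {P : Matrix (Fin p) (Fin p) ℂ} (hP : P.PosSemidef)
    (hPδ : frobNorm (P - 1) ≤ δ) :
    ∃ (U : Matrix (Fin p) (Fin p) ℂ) (d : Fin p → ℝ) (V : Matrix (Fin n) (Fin n) ℂ)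
      (μ : Fin n → ℝ) (g : ℝ), Uᴴ * U = 1 ∧ Vᴴ * V = 1 ∧ P = conjDiag U d ∧
      Φ P = conjDiag V μ ∧ ∑ i, (d i - 1) ^ 2 = frobNorm (P - 1) ^ 2 ∧
      (∀ j, μ j = ∑ i, weight Φ U V i j * d i) ∧ (∀ j, 0 < μ j) ∧ 0 < g ∧ g ^ n = ∏ j, μ j ∧
      ∀ j, |g / μ j - 1| ≤ 6 * δ := by
  obtain ⟨U, d, hU, hPU⟩ := hP.isHermitian.exists_eq_conjDiag
  obtain ⟨V, μ, hV, hPV⟩ := (h.1.posSemidef hP).isHermitian.exists_eq_conjDiag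
  have hfrob : ∑ i, (d i - 1) ^ 2 = frobNorm (P - 1) ^ 2 := by
    rw [hPU, conjDiag_sub_one hU, frobNorm_conjDiag hU, Real.sq_sqrt (by positivity)]
  have hf0 : 0 ≤ frobNorm (P - 1) := by rw [frobNorm_eq]; positivity
  have hd : ∀ i, |d i - 1| ≤ δ := fun i => by
    refine abs_le_of_sq_le_sq ?_ hδ0
    refine (Finset.single_le_sum (f := fun i => (d i - 1) ^ 2)
      (fun i _ => sq_nonneg _) (Finset.mem_univ i)).trans ?_
    rw [hfrob]
    exact pow_le_pow_left₀ hf0 hPδ 2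
  have hμ : ∀ j, μ j = ∑ i, weight Φ U V i j * d i := fun j => by
    rw [← re_trace_conjDiag_single_mul_conjDiag hV j μ, ← hPV, hPU, re_trace_conjDiag_mul_map]
    exact Finset.sum_congr rfl fun i _ => by simp [Pi.single_apply]
  have hb := fun j => sum_mul_mem_Icc (h.1.weight_nonneg (U := U) (V := V)) hs.le hε hδ0
    (by linarith) (h.2.1.abs_sum_weight_sub_le hU hV) hd j
  simp only [← hμ] at hb
  have hq : 0 < size Φ / n := by positivity
  have hμ0 : ∀ j, 0 < μ j := fun j =>
    (mul_pos (by linarith) (mul_pos (by linarith) hq)).trans_le (hb j).1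
  have hprod : 0 < ∏ j, μ j := Finset.prod_pos fun j _ => hμ0 j
  refine ⟨U, d, V, μ, (∏ j, μ j) ^ (n : ℝ)⁻¹, hU, hV, hPU, hPV, hfrob, hμ, hμ0,
    Real.rpow_pos_of_pos hprod _, Real.rpow_inv_natCast_pow hprod.le hn.ne', ?_⟩
  exact abs_geomMean_div_sub_one_le hq hδ0 hδ (fun j => (hb j).1) (fun j => (hb j).2)
    (Real.rpow_pos_of_pos hprod _) (Real.rpow_inv_natCast_pow hprod.le hn.ne')

/-- A minimiser of `det Φ(P)` in the Frobenius `δ`-ball is an interior point. -/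
theorem IsQuantumExpander.frobNorm_sub_one_lt {ε lam δ : ℝ}
    (h : IsQuantumExpander ε (1 - lam) Φ) (hs : 0 < size Φ) (hp : 0 < p) (hn : 0 < n) (hε : 0 < ε)
    (hlam0 : 0 < lam) (hlam : lam ≤ 1) (hδ : δ = 32 * (ε * √p / lam)) (hεδ : ε ≤ δ)
    (hδ0 : 0 ≤ δ) (hδ1 : δ ≤ 1 / 16) {P : Matrix (Fin p) (Fin p) ℂ} (hP : P.PosSemidef)
    (hdet : P.det = 1) (hPδ : frobNorm (P - 1) ≤ δ) (hle : (Φ P).det.re ≤ (Φ 1).det.re) :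
    frobNorm (P - 1) < δ := by
  obtain ⟨U, d, V, μ, g, hU, hV, rfl, hPV, hfrob, hμ, -, hg0, hg, -⟩ :=
    h.exists_diagonalization hs hn hεδ hδ0 hδ1 hP hPδ
  have hf0 : 0 ≤ frobNorm (conjDiag U d - 1) := by rw [frobNorm_eq]; positivity
  have hdet' : ∏ i, d i = 1 := by
    rw [det_conjDiag hU] at hdet; exact_mod_cast hdet
  -- As `g ^ n = det Φ(P) ≤ det Φ(1)`, this is AM-GM for the eigenvalues of `Φ 1`.
  have hgs : n * g ≤ size Φ := by
    rw [hPV, det_conjDiag hV, Complex.ofReal_re, ← hg] at hle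
    have := mul_le_re_trace_mul (Y := (1 : Matrix (Fin n) (Fin n) ℂ)) Matrix.PosSemidef.one
      Matrix.det_one (h.1.posSemidef Matrix.PosSemidef.one) hle
    simpa [size] using this
  have key := sum_sub_one_sq_lt hp hn (h.1.weight_nonneg (U := U) (V := V)) hs hε hlam0 hlam hδ hδ1
    (sum_sum_weight hU hV) (h.2.1.abs_sum_weight_sub_le' h.1 hU hV)
    (h.2.1.abs_sum_weight_sub_le hU hV) (h.neg_le_sum_weight_mul hU hV) hdet'
    (by rw [hfrob]; exact pow_le_pow_left₀ hf0 hPδ 2) hμ hg0 hg hgs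
  rw [hfrob] at key
  exact lt_of_pow_lt_pow_left₀ 2 hδ0 key

/-- The normalised inverse of `Φ P`. -/
theorem IsQuantumExpander.exists_normalized_inverse {ε lam δ : ℝ}
    (h : IsQuantumExpander ε (1 - lam) Φ) (hs : 0 < size Φ) (hn : 0 < n) (hε : ε ≤ δ)
    (hδ0 : 0 ≤ δ) (hδ : δ ≤ 1 / 16) {P : Matrix (Fin p) (Fin p) ℂ} (hP : P.PosSemidef)
    (hPδ : frobNorm (P - 1) ≤ δ) :
    ∃ (Y : Matrix (Fin n) (Fin n) ℂ) (g : ℝ), Y.PosSemidef ∧ Y.det = 1 ∧ 0 < g ∧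
      Y * Φ P = (g : ℂ) • 1 ∧ g ^ n = (Φ P).det.re ∧ opNorm (1 - Y) ≤ 6 * δ := by
  obtain ⟨U, d, V, μ, g, hU, hV, -, hPV, -, -, hμ0, hg0, hg, hy⟩ :=
    h.exists_diagonalization hs hn hε hδ0 hδ hP hPδ
  refine ⟨conjDiag V fun j => g / μ j, g, posSemidef_conjDiag fun j => (div_pos hg0 (hμ0 j)).le,
    ?_, hg0, ?_, ?_, ?_⟩
  · rw [det_conjDiag hV, Finset.prod_div_distrib, ← hg]
    simp [hg0.ne']
  · rw [hPV, conjDiag_mul hV, ← conjDiag_const hV]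
    congr 1
    funext j
    exact div_mul_cancel₀ g (hμ0 j).ne'
  · rw [hPV, det_conjDiag hV, Complex.ofReal_re, hg]
  · have h1 : (1 : Matrix (Fin n) (Fin n) ℂ) = conjDiag V fun _ => 1 := by
      rw [conjDiag_const hV]; simp
    rw [h1, conjDiag_sub]
    exact opNorm_conjDiag_le hV (by linarith) fun j => by rw [abs_sub_comm]; exact hy j

/-! ### Existence of a minimiser and construction of the scaling -/

theorem isClosed_posSemidef (m : ℕ) : IsClosed {P : Matrix (Fin m) (Fin m) ℂ | P.PosSemidef} := by
  have : {P : Matrix (Fin m) (Fin m) ℂ | P.PosSemidef} =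
      {P | Pᴴ = P} ∩ ⋂ x : Fin m → ℂ, {P | 0 ≤ star x ⬝ᵥ (P *ᵥ x)} := by
    ext P
    simp only [Set.mem_ofPred_eq, Set.mem_inter_iff, Set.mem_iInter]
    exact Matrix.posSemidef_iff_dotProduct_mulVec
  rw [this]
  refine (isClosed_eq (by fun_prop) continuous_id).inter (isClosed_iInter fun x => ?_)
  exact isClosed_le continuous_const (by fun_prop)

theorem isCompact_posSemidef_det_eq_one_frobNorm_le (m : ℕ) (δ : ℝ) :
    IsCompact {P : Matrix (Fin m) (Fin m) ℂ |
      P.PosSemidef ∧ P.det = 1 ∧ frobNorm (P - 1) ≤ δ} := by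
  have hK : IsCompact (Set.univ.pi fun i => Set.univ.pi fun j =>
      Metric.closedBall ((1 : Matrix (Fin m) (Fin m) ℂ) i j) δ : Set (Fin m → Fin m → ℂ)) :=
    isCompact_univ_pi fun i => isCompact_univ_pi fun j => isCompact_closedBall _ _
  refine IsCompact.of_isClosed_subset (X := Matrix (Fin m) (Fin m) ℂ) hK ?_ ?_
  · refine (isClosed_posSemidef m).inter (IsClosed.inter ?_ ?_)
    · exact isClosed_eq (by fun_prop) continuous_const
    · exact isClosed_le (continuous_frobNorm.comp (by fun_prop)) continuous_const
  · rintro P ⟨-, -, hP⟩ i - j -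
    rw [Metric.mem_closedBall, dist_eq_norm]
    refine le_trans ?_ hP
    rw [frobNorm_eq]
    refine Real.le_sqrt_of_sq_le ?_
    calc ‖P i j - (1 : Matrix (Fin m) (Fin m) ℂ) i j‖ ^ 2 ≤ ∑ j, ‖(P - 1) i j‖ ^ 2 :=
          Finset.single_le_sum (f := fun j => ‖(P - 1) i j‖ ^ 2) (fun _ _ => by positivity)
            (Finset.mem_univ j)
      _ ≤ _ := Finset.single_le_sum (f := fun i => ∑ j, ‖(P - 1) i j‖ ^ 2)
          (fun _ _ => by positivity) (Finset.mem_univ i)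

theorem opNorm_zero (m : ℕ) : opNorm (0 : Matrix (Fin m) (Fin m) ℂ) = 0 := by
  simp [opNorm]

/-- The scalars need no separate normalisation: taking traces, and using adjointness, forces both `n
g` and `p k` to equal the size. -/
theorem isDoublyBalanced_of_eq_smul_one (hp : 0 < p) (hn : 0 < n) {g k : ℝ}
    (h1 : Φ 1 = (g : ℂ) • 1) (h2 : dual Φ 1 = (k : ℂ) • 1) : IsDoublyBalanced Φ := by
  have hp0 : (p : ℝ) ≠ 0 := by positivity
  have hn0 : (n : ℝ) ≠ 0 := by positivity
  have hs : size Φ = n * g := by simp [size, h1, mul_comm]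
  have hk : size Φ = p * k := by
    have h := trace_conjTranspose_mul_dual Φ 1 1
    rw [h1, h2] at h
    simp only [Matrix.conjTranspose_one, Matrix.one_mul, Matrix.mul_one, Matrix.conjTranspose_smul,
      Matrix.trace_smul, Matrix.trace_one, Fintype.card_fin, smul_eq_mul] at h
    have h' := congrArg Complex.re h
    simp at h'
    rw [hs]
    linarith
  constructor
  · rw [h1, hs, mul_div_cancel_left₀ _ hn0, sub_self, opNorm_zero]; simp
  · rw [h2, hk, mul_div_cancel_left₀ _ hp0, sub_self, opNorm_zero]; simp

theorem IsCompletelyPositive.size_nonneg (hΦ : IsCompletelyPositive Φ) : 0 ≤ size Φ :=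
  (Complex.nonneg_iff.1 (hΦ.posSemidef Matrix.PosSemidef.one).trace_nonneg).1

theorem scaling_one_one : scaling Φ 1 1 = Φ := by
  ext1 X
  simp [scaling]

theorem frobNorm_zero (m : ℕ) : frobNorm (0 : Matrix (Fin m) (Fin m) ℂ) = 0 := by
  simp [frobNorm_eq]

/-- A quantum expander whose balance defect is small compared with its spectral gap can be scaled
to a doubly balanced map. -/
theorem IsQuantumExpander.exists_scaling {ε lam δ : ℝ}
    (h : IsQuantumExpander ε (1 - lam) Φ) (hs : 0 < size Φ) (hp : 0 < p) (hn : 0 < n) (hε : 0 < ε)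
    (hlam0 : 0 < lam) (hlam : lam ≤ 1) (hδ : δ = 32 * (ε * √p / lam)) (hδ1 : δ ≤ 1 / 16) :
    ∃ (L : Matrix (Fin p) (Fin p) ℂ) (R : Matrix (Fin n) (Fin n) ℂ),
      L.det = 1 ∧ R.det = 1 ∧ IsDoublyBalanced (scaling Φ L R) ∧
      frobNorm (1 - Lᴴ * L) ≤ δ ∧ opNorm (1 - Rᴴ * R) ≤ 6 * δ := by
  have hp1 : (1 : ℝ) ≤ √p := Real.one_le_sqrt.2 (by exact_mod_cast hp)
  have hδ0 : 0 ≤ δ := by rw [hδ]; positivity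
  have hεδ : ε ≤ δ := by
    have h1 : ε ≤ ε * √p := le_mul_of_one_le_right hε.le hp1
    have h2 : ε * √p ≤ ε * √p / lam := le_div_self (by positivity) hlam0 hlam
    have h3 : 0 ≤ ε * √p / lam := by positivity
    linarith
  have hcont : Continuous fun P => (Φ P).det.re := by
    have : Continuous Φ := Φ.continuous_of_finiteDimensional
    fun_prop
  obtain ⟨P, ⟨hP, hPdet, hPδ⟩, hmin⟩ :=
    (isCompact_posSemidef_det_eq_one_frobNorm_le p δ).exists_isMinOn
      ⟨1, Matrix.PosSemidef.one, Matrix.det_one, by simpa [frobNorm_zero] using hδ0⟩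
      hcont.continuousOn
  have hlt := h.frobNorm_sub_one_lt hs hp hn hε hlam0 hlam hδ hεδ hδ0 hδ1 hP hPdet hPδ
    (hmin ⟨Matrix.PosSemidef.one, Matrix.det_one, by simpa [frobNorm_zero] using hδ0⟩)
  obtain ⟨Y, g, hY, hYdet, hg0, hYP, hg, hYδ⟩ :=
    h.exists_normalized_inverse hs hn hεδ hδ0 hδ1 hP hPδ
  obtain ⟨S, hS, hSdet, rfl⟩ := exists_sqrt_of_det_eq_one hP hPdet
  obtain ⟨R, hR, hRdet, rfl⟩ := exists_sqrt_of_det_eq_one hY hYdet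
  have hSe := hS.isHermitian.eq
  have hRe := hR.isHermitian.eq
  have htrace : ∀ Q : Matrix (Fin p) (Fin p) ℂ, Q.PosSemidef →
      (S * dual Φ (R * R) * S * Q).trace = (R * R * Φ (S * Q * S)).trace := fun Q hQ => by
    have hSQ := hQ.mul_mul_conjTranspose_same S
    rw [hSe] at hSQ
    rw [← h.1.trace_dual_mul hSQ, Matrix.mul_assoc, Matrix.mul_assoc, Matrix.trace_mul_comm]
    simp only [Matrix.mul_assoc]
  have hW : (S * dual Φ (R * R) * S).IsHermitian := by
    have := (h.1.posSemidef_dual hY).mul_mul_conjTranspose_same S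
    rw [hSe] at this
    exact this.isHermitian
  -- Substituting `S * Q * S` moves the minimiser to `Q = 1`. Because the minimiser is interior,
  -- every `Q` near 1 that is positive with determinant one stays admissible, so AM-GM bounds its
  -- trace below by `n g`, the value at `Q = 1`.
  obtain ⟨k, hk⟩ := exists_eq_smul_one_of_isLocalMin hW <| by
    have hc : Continuous fun Q : Matrix (Fin p) (Fin p) ℂ => frobNorm (S * Q * S - 1) :=
      continuous_frobNorm.comp (by fun_prop)
    have hev := hc.continuousAt.eventually_lt (x₀ := 1) (g := fun _ => δ) continuousAt_const
      (by simpa using hlt)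
    filter_upwards [hev] with Q hQδ hQ hQdet
    have hSQ := hQ.mul_mul_conjTranspose_same S
    rw [hSe] at hSQ
    have h1 : g ^ n ≤ (Φ (S * Q * S)).det.re := by
      rw [hg]
      exact hmin ⟨hSQ, by simp [Matrix.det_mul, hSdet, hQdet], hQδ.le⟩
    have h2 := mul_le_re_trace_mul hY hYdet (h.1.posSemidef hSQ) h1
    rw [htrace Q hQ]
    refine le_trans (le_of_eq ?_) h2
    have h3 := htrace 1 Matrix.PosSemidef.one
    rw [Matrix.mul_one, Matrix.mul_one, hYP] at h3
    rw [h3]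
    simp [mul_comm]
  have hneg : ∀ {m : ℕ} (A : Matrix (Fin m) (Fin m) ℂ), frobNorm (1 - A) = frobNorm (A - 1) :=
    fun A => by rw [frobNorm_eq, frobNorm_eq]; simp only [Matrix.sub_apply, norm_sub_rev]
  refine ⟨S, R, hSdet, hRdet, isDoublyBalanced_of_eq_smul_one hp hn (g := g) (k := k) ?_ ?_, ?_, ?_⟩
  · have hg' : (g : ℂ) ≠ 0 := by exact_mod_cast hg0.ne'
    -- A one-sided inverse of a square matrix is two-sided, so `R` can be moved to the right, giving
    -- `R * Φ (S * S) * R = g • 1`.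
    have h1 : R * ((g : ℂ)⁻¹ • (R * Φ (S * S))) = 1 := by
      rw [Matrix.mul_smul, ← Matrix.mul_assoc, hYP, smul_smul, inv_mul_cancel₀ hg', one_smul]
    have h2 := mul_eq_one_comm.1 h1
    rw [Matrix.smul_mul, inv_smul_eq_iff₀ hg'] at h2
    simpa [scaling, hSe, hRe] using h2
  · rw [h.1.dual_scaling, hSe, hRe, Matrix.mul_one, hk]
  · rw [hSe, hneg]; exact hPδ
  · rw [hRe]; exact hYδ

end Positive

end QuantumExpander

end

theorem mainTheorem6 :
    ∃ c C : ℝ, 0 < c ∧ 0 < C ∧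
      ∀ (p n : ℕ) (Φ : Matrix (Fin p) (Fin p) ℂ →ₗ[ℂ] Matrix (Fin n) (Fin n) ℂ) (ε lam : ℝ),
        0 ≤ ε → 0 < lam → lam ≤ 1 →
        QuantumExpander.IsQuantumExpander ε (1 - lam) Φ →
        ε * Real.sqrt p / lam ≤ c →
        ∃ (L : Matrix (Fin p) (Fin p) ℂ) (R : Matrix (Fin n) (Fin n) ℂ),
          L.det = 1 ∧ R.det = 1 ∧
          QuantumExpander.IsDoublyBalanced (QuantumExpander.scaling Φ L R) ∧
          QuantumExpander.frobNorm (1 - L.conjTranspose * L) ≤ C * (ε * Real.sqrt p / lam) ∧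
          QuantumExpander.opNorm (1 - R.conjTranspose * R) ≤ C * (ε * Real.sqrt p / lam) := by
  -- With `δ = 32 ε √p / λ`, the bound 1/512 ensures `δ ≤ 1/16`, and `192 = 6 * 32` comes from the
  -- `6 * δ` bound on `R`.
  refine ⟨1 / 512, 192, by norm_num, by norm_num, ?_⟩
  intro p n Φ ε lam hε hlam0 hlam h hc
  have hκ : 0 ≤ ε * √p / lam := by positivity
  -- This case absorbs all degenerate ones: `ε = 0`, size zero, and hence `p = 0` or `n = 0`, where
  -- `Φ` is already balanced and `L = R = 1` works.
  by_cases htriv : QuantumExpander.IsDoublyBalanced Φ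
  · refine ⟨1, 1, Matrix.det_one, Matrix.det_one, ?_, ?_, ?_⟩
    · rwa [QuantumExpander.scaling_one_one]
    · simpa [QuantumExpander.frobNorm_zero] using hκ
    · simpa [QuantumExpander.opNorm_zero] using hκ
  have hε0 : 0 < ε := hε.lt_of_ne fun h0 => htriv (by subst h0; exact h.2.1)
  have hs0 : QuantumExpander.size Φ ≠ 0 := fun h0 => htriv <| by
    have h1 := h.2.1
    simp only [QuantumExpander.IsDoublyBalanced, QuantumExpander.IsEpsDoublyBalanced, h0,
      zero_mul] at h1 ⊢
    exact h1
  have hs := h.1.size_nonneg.lt_of_ne hs0.symm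
  have hn : 0 < n := Nat.pos_of_ne_zero fun h0 => hs0 <| by
    subst h0; simp [QuantumExpander.size, Matrix.trace]
  have hp : 0 < p := Nat.pos_of_ne_zero fun h0 => hs0 <| by
    subst h0
    rw [QuantumExpander.size, Subsingleton.elim (1 : Matrix (Fin 0) (Fin 0) ℂ) 0, map_zero]
    simp
  obtain ⟨L, R, hL, hR, hbal, h1, h2⟩ :=
    h.exists_scaling hs hp hn hε0 hlam0 hlam rfl (by linarith)
  exact ⟨L, R, hL, hR, hbal, h1.trans (by linarith), h2.trans (by linarith)⟩
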